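/- **Setting.** Let $G=\mathrm{PSL}(2,\mathbb R)$ and let $a_t,b_s,c_u,d_\pi\in G$ be the classes of $\begin{pmatrix}e^{t/2}&0\\0&e^{-t/2}\end{pmatrix}$, $\begin{pmatrix}1&s\\0&1\end{pmatrix}$, $\begin{pmatrix}1&0\\u&1\end{pmatrix}$, $\begin{pmatrix}0&1\\-1&0\end{pmatrix}$. Let $d_G$ be the distance on $G$ of the left-invariant Riemannian metric given by $\langle A,B\rangle=\mathrm{tr}(A^{\top}B)$ on $\mathfrak{sl}(2,\mathbb R)$. Let $\Gamma\subset G$ be a discrete subgroup such that $X=\Gamma\backslash G$ is compact, with the geodesic flow $\varphi_t(\Gamma g)=\Gamma g a_t$, the time reversal $\mathcal T(\Gamma g)=\Gamma g d_\pi$ and $d_X(\Gamma g,\Gamma h)=\inf_{\gamma,\gamma'\in\Gamma}d_G(\gamma g,\gamma' h)$. For $x=\Gamma g$ and $\varepsilon>0$ put $\mathcal P_\varepsilon(x)=\{\Gamma g c_ub_s:\ |u|<\varepsilon,\ |s|<\varepsilon\}$; we write $y=(u,s)_x$ if $y=\Gamma g c_ub_s$ with such $u,s$. A $T$-periodic orbit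 ($T>0$) is the orbit of a point $x$ with $\varphi_T(x)=x$. Let $\varepsilon_*>0$ be a number (depending only on $\Gamma$) with the following property: if $0<\varepsilon<\varepsilon_*$ and $x_1,x_2\in X$ are periodic with periods $T_1,T_2>0$, $|T_1-T_2|\le\sqrt2\,\varepsilon$ and $d_X(\varphi_t(x_1),\varphi_t(x_2))<\varepsilon$ for all $t\in[0,\min\{T_1,T_2\}]$, then $x_1$ and $x_2$ have the same orbit. A $T'$-periodic orbit $c'$ is a *$\delta$-partner* of a $T$-periodic orbit $c$ if there are $L\ge2$, a permutation $P$ of $\{1,\dots,L\}$, points $y_1,\dots,y_L\in c$, $y'_1,\dots,y'_L\in c'$ and times $S_j,S'_j>0$ with $\sum_j S_j=T$, $\sum_j S'_j=T'$, $\varphi_{S_j}(y_j)=y_{j+1}$, $\varphi_{S'_{P(j)}}(y'_j)=y'_{P(j)+1}$ (indices mod $L$), such that for each $j$ either $d_X(\varphi_t(y'_j),\varphi_t(y_{P(j)}))<\delta$ for all $t\in[0,\max\{S_{P(j)},S'_{P(j)}\}]$, or $d_X(\varphi_{t-S'_{P(j)}}(\mathcal T y'_j),\varphi_t(y_{P(j)}))<\delta$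 for all these $t$. An orbit has a *(parallel) $(L,\varepsilon)$-encounter* if it contains points $p_1,\dots,p_L$ such that, for some $x\in X$, all $p_j$ or all $\mathcal T(p_j)$ lie in $\mathcal P_\varepsilon(x)$. **Theorem.** Let $0<\varepsilon<\varepsilon_*/11$ and let $c$ be a $T$-periodic orbit with points $x_j\in c\cap\mathcal P_{\varepsilon/3}(x)$, $x_j=(u_j,s_j)_x$, $j=1,2,3$, for some $x\in X$. Let $T_1,T_2,T_3>0$ satisfy $T=T_1+T_2+T_3$, $\varphi_{T_1}(x_1)=x_2$, $\varphi_{T_2}(x_2)=x_3$, $\varphi_{T_3}(x_3)=x_1$, and assume, for all $i\ne j$ (indices mod $3$), $$|u_j-u_i|>\tfrac65(e^{-T_j}+e^{-T_i}),\qquad |s_j-s_i|>\tfrac{24}{3^3}\varepsilon^3+e^{-T_{j-1}}+e^{-T_{i-1}} .$$ Then $c$ has an $11\varepsilon$-partner $c'$ whose period $T'$ satisfies $$\Big|\frac{T'-T}2-\Delta S_3\Big|<76\varepsilon^4+22\varepsilon^2e^{-T_1}+7\varepsilon^2e^{-T_2}+7\varepsilon^2e^{-T_3},$$ $$\Delta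 S_3=\ln\big(1+(u_3-u_1)(s_3-s_2)\big)+\ln\big(1+(u_2-u_1)(s_2-s_1)\big),$$ and $c'$ has a $(3,\varepsilon)$-encounter. More precisely, with $P(1)=2$, $P(2)=3$, $P(3)=1$, there are $v_1,v_2,v_3\in c'$ and $T'_1,T'_2,T'_3>0$ such that, for $j=1,2,3$: (a) $\varphi_{T'_2}(v_1)=v_3$, $\varphi_{T'_3}(v_2)=v_1$, $\varphi_{T'_1}(v_3)=v_2$ and $T'=T'_1+T'_2+T'_3$; (b) $v_j\in\mathcal P_\varepsilon(x)$, $v_j=(u'_j,s'_j)_x$, where $|u'_j-u_{P(j)}|$ and $|s'_j-s_j|$ are both less than $23\varepsilon^3+6\varepsilon(e^{-T_1}+e^{-T_2}+e^{-T_3})$; (c) $|T'_j-T_j|<22\varepsilon^2$; (d) $d_X(\varphi_t(v_j),\varphi_t(x_{P(j)}))<10\varepsilon$ for all $t\in[0,\max\{T_{P(j)},T'_{P(j)}\}]$; (e) $(u'_j,s'_j)\ne(u_i,s_i)$ for all $i,j$. Moreover, if $4\varepsilon<\sigma_0$ for some $\sigma_0$ with $d_G(g,\gamma g)\ge\sigma_0$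 for all $g\in G$, $\gamma\in\Gamma\setminus\{1\}$, then $v_j\ne x_i$ for all $i,j$; in that case $c'\ne c$ if $c$ meets $\mathcal P_\varepsilon(x)$ at most in $x_1,x_2,x_3$, and $c'\neq\mathcal T(c)$ if $\mathcal T(c)$ meets $\mathcal P_\varepsilon(x)$ at most in $x_1,x_2,x_3$. -/

import Mathlib

open scoped MatrixGroups

noncomputable section

namespace HypFlow

/-- The group `PSL(2, ℝ) = SL(2, ℝ) / {±1}`. -/
abbrev G : Type := Matrix.ProjectiveSpecialLinearGroup (Fin 2) ℝ

/-- The projection `SL(2, ℝ) → PSL(2, ℝ)`. -/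
def proj : SL(2, ℝ) →* G := QuotientGroup.mk' (Subgroup.center SL(2, ℝ))

/-- The class of `diag (e^{t/2}, e^{-t/2})`. -/
def a (t : ℝ) : G :=
  proj ⟨!![Real.exp (t / 2), 0; 0, Real.exp (-(t / 2))], by
    simp [Matrix.det_fin_two_of, ← Real.exp_add]⟩

/-- The class of the upper unipotent matrix with entry `s`. -/
def b (s : ℝ) : G := proj ⟨!![1, s; 0, 1], by simp [Matrix.det_fin_two_of]⟩

/-- The class of the lower unipotent matrix with entry `u`. -/
def c (u : ℝ) : G := proj ⟨!![1, 0; u, 1], by simp [Matrix.det_fin_two_of]⟩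

/-- The class of the rotation matrix `(0 1; -1 0)`, used for time reversal. -/
def dπ : G := proj ⟨!![0, 1; -1, 0], by simp [Matrix.det_fin_two_of]⟩

/-- The entrywise derivative of a curve in `SL(2, ℝ)`. -/
def velocity (κ : ℝ → SL(2, ℝ)) (t : ℝ) : Matrix (Fin 2) (Fin 2) ℝ :=
  Matrix.of fun i j => deriv (fun r => (κ r).1 i j) t

/-- The speed of a curve in `SL(2, ℝ)` for the left-invariant Riemannian metric that is
`⟨A, B⟩ = tr (Aᵀ B)` on the Lie algebra: the norm of `κ⁻¹ κ'`. -/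
def speed (κ : ℝ → SL(2, ℝ)) (t : ℝ) : ℝ :=
  let M : Matrix (Fin 2) (Fin 2) ℝ := ((κ t)⁻¹).1 * velocity κ t
  Real.sqrt (Matrix.trace (M.transpose * M))

/-- The Riemannian distance on `PSL(2, ℝ)`: the infimum of the lengths over `[0, 1]` of `C¹` curves
from `g` to `h`. Curves in `PSL(2, ℝ)` are given by their lifts to the double cover
`SL(2, ℝ)`. -/
def distG (g h : G) : ℝ :=
  sInf {l : ℝ | ∃ κ : ℝ → SL(2, ℝ), (∀ i j, ContDiff ℝ 1 fun t => (κ t).1 i j) ∧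
    proj (κ 0) = g ∧ proj (κ 1) = h ∧ l = ∫ t in (0 : ℝ)..1, speed κ t}

/-- The space `X = Γ \ PSL(2, ℝ)` of right cosets `Γ g`. It carries the quotient topology. -/
abbrev X (Γ : Subgroup G) : Type := Quotient (QuotientGroup.rightRel Γ)

variable (Γ : Subgroup G)

/-- The coset `Γ g`. -/
def mk (g : G) : X Γ := Quotient.mk (QuotientGroup.rightRel Γ) g

/-- Right translation `Γ g ↦ Γ g h` on the coset space. -/
def rightMul (h : G) : X Γ → X Γ :=
  Quotient.map (fun g => g * h) (by
    intro g₁ g₂ hg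
    have hg' := QuotientGroup.rightRel_apply.mp hg
    refine QuotientGroup.rightRel_apply.mpr ?_
    simpa [mul_assoc] using hg')

/-- The distance on `X`: the infimum of `distG g h` over all representatives. -/
def distX (x y : X Γ) : ℝ :=
  sInf {r : ℝ | ∃ g h : G, mk Γ g = x ∧ mk Γ h = y ∧ r = distG g h}

/-- The geodesic flow `φ_t (Γ g) = Γ g a_t`. -/
def flow (t : ℝ) : X Γ → X Γ := rightMul Γ (a t)

/-- The time reversal map on `X`. -/
def timeRev : X Γ → X Γ := rightMul Γ dπ

/-- The orbit of a point, as a subset of `X`. -/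
def orbit (x : X Γ) : Set (X Γ) := Set.range fun t : ℝ => flow Γ t x

/-- `C` is a `T`-periodic orbit of the flow (`T` need not be the minimal period). -/
def IsPeriodicOrbit (C : Set (X Γ)) (T : ℝ) : Prop :=
  0 < T ∧ ∃ x : X Γ, flow Γ T x = x ∧ C = orbit Γ x

/-- `y` lies in the Poincaré section of radius `ε` at `x` and `y = (u, s)_x`: `u` and `s` are
the unstable and the stable coordinate of `y`. -/
def HasCoords (ε : ℝ) (x y : X Γ) (u s : ℝ) : Prop :=
  |u| < ε ∧ |s| < ε ∧ ∃ g : G, x = mk Γ g ∧ y = mk Γ (g * c u * b s)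

/-- The Poincaré section of radius `ε` at `x`. -/
def poincareSection (ε : ℝ) (x : X Γ) : Set (X Γ) :=
  {y | ∃ u s : ℝ, HasCoords Γ ε x y u s}

/-- The number `e` is positive, and two periodic orbits whose periods differ by at most `√2 ε`
and which stay `ε`-close during the shorter one are identical, for each `ε < e`. -/
def IsCoincidenceConstant (e : ℝ) : Prop :=
  0 < e ∧ ∀ ε : ℝ, 0 < ε → ε < e → ∀ (x₁ x₂ : X Γ) (T₁ T₂ : ℝ), 0 < T₁ → 0 < T₂ →
    flow Γ T₁ x₁ = x₁ → flow Γ T₂ x₂ = x₂ → |T₁ - T₂| ≤ Real.sqrt 2 * ε →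
    (∀ t ∈ Set.Icc 0 (min T₁ T₂), distX Γ (flow Γ t x₁) (flow Γ t x₂) < ε) →
    orbit Γ x₁ = orbit Γ x₂

/-- The `T`-periodic orbit `C` and the `T'`-periodic orbit `C'` form a `δ`-orbit pair, that is,
`C'` is a `δ`-partner orbit of `C`. Here `finRotate L` is the cyclic successor on `L` indices. -/
def IsPartnerOrbit (δ : ℝ) (C : Set (X Γ)) (T : ℝ) (C' : Set (X Γ)) (T' : ℝ) : Prop :=
  IsPeriodicOrbit Γ C T ∧ IsPeriodicOrbit Γ C' T' ∧
  ∃ L : ℕ, 2 ≤ L ∧ ∃ (P : Equiv.Perm (Fin L)) (x x' : Fin L → X Γ) (τ τ' : Fin L → ℝ),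
    (∀ j, x j ∈ C) ∧ (∀ j, x' j ∈ C') ∧ (∀ j, 0 < τ j) ∧ (∀ j, 0 < τ' j) ∧
    T = ∑ j, τ j ∧ T' = ∑ j, τ' j ∧
    (∀ j, flow Γ (τ j) (x j) = x (finRotate L j)) ∧
    (∀ j, flow Γ (τ' (P j)) (x' j) = x' (finRotate L (P j))) ∧
    ∀ j,
      (∀ t ∈ Set.Icc 0 (max (τ (P j)) (τ' (P j))),
        distX Γ (flow Γ t (x' j)) (flow Γ t (x (P j))) < δ) ∨
      (∀ t ∈ Set.Icc 0 (max (τ (P j)) (τ' (P j))),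
        distX Γ (flow Γ (t - τ' (P j)) (timeRev Γ (x' j))) (flow Γ t (x (P j))) < δ)

/-- The orbit `C` has an `(L, ε)`-encounter that is parallel. -/
def HasParallelEncounter (L : ℕ) (ε : ℝ) (C : Set (X Γ)) : Prop :=
  ∃ (x : X Γ) (p : Fin L → X Γ), (∀ j, p j ∈ C) ∧
    ((∀ j, p j ∈ poincareSection Γ ε x) ∨ (∀ j, timeRev Γ (p j) ∈ poincareSection Γ ε x))

end HypFlow

end

open scoped MatrixGroups

noncomputable section

namespace HypFlow

/-! ### Lifts of the one-parameter subgroups -/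

/-! The partner is built explicitly in the coordinates of the section at `x₀`. Its point `v j`
should have the past of `x j` and the future of `x (j + 1)`, hence coordinates close to `(u (j + 1),
s j)`. For the `j`-th stretch it must run from `v (j + 2)` to `v (j + 1)` alongside the stretch of
`c` from `x j` to `x (j + 1)`.

Since `x₀` is fixed by the group element that encodes the `j`-th stretch of `c`, the new stretch
exists as soon as one identity of 2×2 matrices holds (`transfer_eq`, `flow_point_eq`). This identity
is triangular. The unstable coordinate at the start is a function of the unstable coordinate at the
end alone, damped by `exp (-τ j)`. Once the unstable coordinates are known, the stable coordinate at
the end is a function of the one at the start, with the same damping. Going round the three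
stretches gives two fixed point problems for continuous self-maps of an interval, solved one after
the other (`exists_cycle`, `exists_unstable_coords`, `exists_stable_coords`).

The change of the return time is `2 * log (l j)`, where `l j` is the quotient of the upper left
matrix entries. Linearising the logarithms and summing by parts yields the action difference
(`action_estimate`). Closeness of the orbits follows from the length of one curve made of unipotents
(`distG_mul_unipotents_le`), and the separation hypotheses supply both the smallness of all
parameters and the distinctness of the new points. -/

/-- The lift of `a t` with positive diagonal. -/
def aLift (t : ℝ) : SL(2, ℝ) :=
  ⟨!![Real.exp (t / 2), 0; 0, Real.exp (-(t / 2))], by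
    simp [Matrix.det_fin_two_of, ← Real.exp_add]⟩

/-- The unipotent lift of `b s`. -/
def bLift (s : ℝ) : SL(2, ℝ) := ⟨!![1, s; 0, 1], by simp [Matrix.det_fin_two_of]⟩

/-- The unipotent lift of `c u`. -/
def cLift (u : ℝ) : SL(2, ℝ) := ⟨!![1, 0; u, 1], by simp [Matrix.det_fin_two_of]⟩

lemma proj_aLift (t : ℝ) : proj (aLift t) = a t := rfl

lemma proj_bLift (s : ℝ) : proj (bLift s) = b s := rfl

lemma proj_cLift (u : ℝ) : proj (cLift u) = c u := rfl

lemma coe_aLift (t : ℝ) :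
    (aLift t : Matrix (Fin 2) (Fin 2) ℝ) = !![Real.exp (t / 2), 0; 0, Real.exp (-(t / 2))] := rfl

lemma coe_bLift (s : ℝ) : (bLift s : Matrix (Fin 2) (Fin 2) ℝ) = !![1, s; 0, 1] := rfl

lemma coe_cLift (u : ℝ) : (cLift u : Matrix (Fin 2) (Fin 2) ℝ) = !![1, 0; u, 1] := rfl

/-! ### Upper bounds for the distances -/

lemma speed_nonneg (κ : ℝ → SL(2, ℝ)) (t : ℝ) : 0 ≤ speed κ t := Real.sqrt_nonneg _

lemma length_nonneg (κ : ℝ → SL(2, ℝ)) : 0 ≤ ∫ t in (0 : ℝ)..1, speed κ t :=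
  intervalIntegral.integral_nonneg zero_le_one fun t _ => speed_nonneg κ t

lemma distG_nonneg (g h : G) : 0 ≤ distG g h := by
  refine Real.sInf_nonneg ?_
  rintro l ⟨κ, -, -, -, rfl⟩
  exact length_nonneg κ

lemma distX_mk_le (Γ : Subgroup G) (g h : G) : distX Γ (mk Γ g) (mk Γ h) ≤ distG g h := by
  refine csInf_le ⟨0, ?_⟩ ⟨g, h, rfl, rfl, rfl⟩
  rintro l ⟨g, h, -, -, rfl⟩
  exact distG_nonneg g h

lemma distG_le_length (κ : ℝ → SL(2, ℝ)) (hκ : ∀ i j, ContDiff ℝ 1 fun t => (κ t).1 i j) :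
    distG (proj (κ 0)) (proj (κ 1)) ≤ ∫ t in (0 : ℝ)..1, speed κ t := by
  refine csInf_le ⟨0, ?_⟩ ⟨κ, hκ, rfl, rfl, rfl⟩
  rintro l ⟨κ, -, -, -, rfl⟩
  exact length_nonneg κ

/-- The curve `t ↦ b (t x) * c (t y) * b (t z)`, lifted to `SL(2, ℝ)`. -/
def unipotentCurve (x y z t : ℝ) : SL(2, ℝ) := bLift (t * x) * cLift (t * y) * bLift (t * z)

lemma coe_unipotentCurve (x y z t : ℝ) : (unipotentCurve x y z t : Matrix (Fin 2) (Fin 2) ℝ) =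
    !![1 + t * x * (t * y), t * z + t * x * (1 + t * y * (t * z)); t * y, 1 + t * y * (t * z)] := by
  simp only [unipotentCurve, Matrix.SpecialLinearGroup.coe_mul, coe_bLift, coe_cLift]
  ext i j
  fin_cases i <;> fin_cases j <;> simp [Matrix.mul_apply, Fin.sum_univ_two] <;> ring

lemma proj_unipotentCurve_one (x y z : ℝ) :
    proj (unipotentCurve x y z 1) = b x * c y * b z := by
  simp only [unipotentCurve, one_mul, map_mul, proj_bLift, proj_cLift]

lemma unipotentCurve_zero (x y z : ℝ) : unipotentCurve x y z 0 = 1 := by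
  ext i j
  fin_cases i <;> fin_cases j <;> simp [coe_unipotentCurve]

lemma contDiff_unipotentCurve (x y z : ℝ) (i j : Fin 2) :
    ContDiff ℝ 1 fun t => (unipotentCurve x y z t).1 i j := by
  fin_cases i <;> fin_cases j <;> simp [coe_unipotentCurve] <;> fun_prop

lemma velocity_mul_left (h : SL(2, ℝ)) (κ : ℝ → SL(2, ℝ))
    (hκ : ∀ i j, ContDiff ℝ 1 fun t => (κ t).1 i j) (t : ℝ) :
    velocity (fun r => h * κ r) t = h.1 * velocity κ t := by
  have hd : ∀ i j, DifferentiableAt ℝ (fun t => (κ t).1 i j) t := fun i j =>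
    ((hκ i j).differentiable one_ne_zero) t
  ext i j
  have h1 : (fun r => (h * κ r).1 i j) = fun r => h.1 i 0 * (κ r).1 0 j + h.1 i 1 * (κ r).1 1 j := by
    funext r
    simp [Matrix.mul_apply, Fin.sum_univ_two]
  simp only [velocity, Matrix.of_apply, Matrix.mul_apply, Fin.sum_univ_two]
  rw [h1]
  exact (((hd 0 j).hasDerivAt.const_mul _).add ((hd 1 j).hasDerivAt.const_mul _)).deriv

lemma speed_mul_left (h : SL(2, ℝ)) (κ : ℝ → SL(2, ℝ))
    (hκ : ∀ i j, ContDiff ℝ 1 fun t => (κ t).1 i j) (t : ℝ) :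
    speed (fun r => h * κ r) t = speed κ t := by
  have h1 : ((h * κ t)⁻¹).1 * velocity (fun r => h * κ r) t = ((κ t)⁻¹).1 * velocity κ t := by
    rw [velocity_mul_left h κ hκ, ← mul_assoc, ← Matrix.SpecialLinearGroup.coe_mul]
    rw [mul_inv_rev, inv_mul_cancel_right]
  simp only [speed, h1]

lemma velocity_unipotentCurve (x y z t : ℝ) : velocity (unipotentCurve x y z) t =
    !![2 * t * (x * y), z + x + 3 * t ^ 2 * (x * y * z); y, 2 * t * (y * z)] := by
  have h2 : HasDerivAt (fun t : ℝ => t ^ 2) (2 * t) t := by simpa using hasDerivAt_pow 2 t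
  have h3 : HasDerivAt (fun t : ℝ => t ^ 3) (3 * t ^ 2) t := by simpa using hasDerivAt_pow 3 t
  have h1 := hasDerivAt_id t
  ext i j
  fin_cases i <;> fin_cases j <;> simp only [velocity, coe_unipotentCurve, Matrix.of_apply]
  · refine HasDerivAt.deriv (((h2.mul_const (x * y)).const_add 1).congr_of_eventuallyEq
      (Filter.Eventually.of_forall fun r => ?_))
    simp; ring
  · have := ((h1.mul_const (z + x)).add (h3.mul_const (x * y * z))).congr_of_eventuallyEq
      (f₁ := fun r => r * z + r * x * (1 + r * y * (r * z)))
      (Filter.Eventually.of_forall fun r => by simp; ring)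
    refine (this.deriv).trans ?_
    simp
  · refine (((h1.mul_const y)).congr_of_eventuallyEq
      (f₁ := fun r => r * y) (Filter.Eventually.of_forall fun r => by simp)).deriv.trans ?_
    simp
  · refine HasDerivAt.deriv (((h2.mul_const (y * z)).const_add 1).congr_of_eventuallyEq
      (Filter.Eventually.of_forall fun r => ?_))
    simp; ring

/-- A traceless matrix with diagonal `p, -p` and off-diagonal entries `q, r` has squared norm `2p² +
q² + r²`. The factor 3/2 is a rational bound for `√2`. -/
lemma sqrt_trace_le {p q r : ℝ} :
    Real.sqrt (2 * p ^ 2 + q ^ 2 + r ^ 2) ≤ 3 / 2 * |p| + |q| + |r| := by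
  refine Real.sqrt_le_iff.2 ⟨by positivity, ?_⟩
  rw [← sq_abs p, ← sq_abs q, ← sq_abs r]
  nlinarith [mul_nonneg (abs_nonneg p) (abs_nonneg q), mul_nonneg (abs_nonneg p) (abs_nonneg r),
    mul_nonneg (abs_nonneg q) (abs_nonneg r), sq_nonneg |p|]

lemma speed_unipotentCurve (x y z t : ℝ) : speed (unipotentCurve x y z) t =
    Real.sqrt (2 * (x * (t * y) * (1 + t * y * (t * z)) - y * (t * z)) ^ 2 +
      (z - y * (t * z) ^ 2 + x * (1 + t * y * (t * z)) ^ 2) ^ 2 + (y - x * (t * y) ^ 2) ^ 2) := by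
  simp only [speed, velocity_unipotentCurve]
  congr 1
  simp [Matrix.SpecialLinearGroup.coe_inv, coe_unipotentCurve, Matrix.adjugate_fin_two_of,
    Matrix.trace_fin_two, Matrix.mul_apply, Fin.sum_univ_two]
  ring

lemma speed_unipotentCurve_le {x y z t X Y Z : ℝ} (hx : |x| ≤ X) (hy : |y| ≤ Y) (hz : |z| ≤ Z)
    (ht : |t| ≤ 1) : speed (unipotentCurve x y z) t ≤
      3 / 2 * (X * Y * (1 + Y * Z) + Y * Z) + (Z + Y * Z ^ 2 + X * (1 + Y * Z) ^ 2) +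
        (Y + X * Y ^ 2) := by
  have hX := (abs_nonneg x).trans hx
  have hY := (abs_nonneg y).trans hy
  have hZ := (abs_nonneg z).trans hz
  have hty : |t * y| ≤ Y := by
    rw [abs_mul]; nlinarith [abs_nonneg y, abs_nonneg t]
  have htz : |t * z| ≤ Z := by
    rw [abs_mul]; nlinarith [abs_nonneg z, abs_nonneg t]
  have hyz : |1 + t * y * (t * z)| ≤ 1 + Y * Z := by
    refine (abs_add_le _ _).trans ?_
    rw [abs_one, abs_mul (t * y)]
    gcongr
  rw [speed_unipotentCurve]
  refine sqrt_trace_le.trans ?_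
  have hyz' : |y * (t * z)| ≤ Y * Z := by rw [abs_mul]; gcongr
  refine add_le_add (add_le_add (mul_le_mul_of_nonneg_left ?_ (by norm_num)) ?_) ?_
  · refine (abs_sub _ _).trans (add_le_add ?_ hyz')
    rw [abs_mul, abs_mul]
    gcongr
  · refine (abs_add_le _ _).trans (add_le_add ((abs_sub _ _).trans ?_) ?_)
    · rw [abs_mul, abs_pow]; gcongr
    · rw [abs_mul, abs_pow]; gcongr
  · refine (abs_sub _ _).trans ?_
    rw [abs_mul, abs_pow]; gcongr

/-- Left invariance moves `unipotentCurve` to start at a lift of `g`. Its speed on the unit interval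
is bounded by a constant, which therefore bounds the length. To first order the bound is `X + Y +
Z`. -/
lemma distG_mul_unipotents_le (g : G) {x y z X Y Z : ℝ} (hx : |x| ≤ X) (hy : |y| ≤ Y)
    (hz : |z| ≤ Z) : distG g (g * (b x * c y * b z)) ≤
      3 / 2 * (X * Y * (1 + Y * Z) + Y * Z) + (Z + Y * Z ^ 2 + X * (1 + Y * Z) ^ 2) +
        (Y + X * Y ^ 2) := by
  obtain ⟨h, rfl⟩ := QuotientGroup.mk'_surjective _ g
  have hsm := contDiff_unipotentCurve x y z
  have hle := distG_le_length (fun t => h * unipotentCurve x y z t) (by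
    intro i j
    simp only [Matrix.SpecialLinearGroup.coe_mul, Matrix.mul_apply, Fin.sum_univ_two]
    exact (contDiff_const.mul (hsm 0 j)).add (contDiff_const.mul (hsm 1 j)))
  simp only [unipotentCurve_zero, mul_one, map_mul, proj_unipotentCurve_one] at hle
  refine hle.trans ((le_abs_self _).trans ?_)
  rw [← Real.norm_eq_abs]
  refine (intervalIntegral.norm_integral_le_of_norm_le_const (C := 
      3 / 2 * (X * Y * (1 + Y * Z) + Y * Z) + (Z + Y * Z ^ 2 + X * (1 + Y * Z) ^ 2) +
        (Y + X * Y ^ 2)) ?_).trans (by simp)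
  intro t ht
  rw [Set.uIoc_of_le zero_le_one] at ht
  rw [speed_mul_left h _ hsm, Real.norm_of_nonneg (speed_nonneg _ _)]
  exact speed_unipotentCurve_le hx hy hz (abs_le.2 ⟨by linarith [ht.1], ht.2⟩)

/-! ### Relations between the one-parameter subgroups -/

lemma a_add (t t' : ℝ) : a (t + t') = a t * a t' := by
  simp only [← proj_aLift, ← map_mul]
  congr 1
  ext i j
  fin_cases i <;> fin_cases j <;>
    simp [Matrix.mul_apply, Fin.sum_univ_two, coe_aLift, ← Real.exp_add] <;> ring

lemma a_zero : a 0 = 1 := by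
  rw [← map_one proj, ← proj_aLift]
  congr 1
  ext i j
  fin_cases i <;> fin_cases j <;> simp [coe_aLift]

lemma b_add (s s' : ℝ) : b (s + s') = b s * b s' := by
  simp only [← proj_bLift, ← map_mul]
  congr 1
  ext i j
  fin_cases i <;> fin_cases j <;>
    simp [Matrix.mul_apply, Fin.sum_univ_two, coe_bLift, add_comm]

lemma b_zero : b 0 = 1 := by
  rw [← map_one proj, ← proj_bLift]
  congr 1
  ext i j
  fin_cases i <;> fin_cases j <;> simp [coe_bLift]

lemma b_neg (s : ℝ) : b (-s) = (b s)⁻¹ := by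
  rw [eq_inv_iff_mul_eq_one, ← b_add, neg_add_cancel, b_zero]

lemma c_add (u u' : ℝ) : c (u + u') = c u * c u' := by
  simp only [← proj_cLift, ← map_mul]
  congr 1
  ext i j
  fin_cases i <;> fin_cases j <;> simp [Matrix.mul_apply, Fin.sum_univ_two, coe_cLift]

lemma b_mul_a (s t : ℝ) : b s * a t = a t * b (s * Real.exp (-t)) := by
  simp only [← proj_aLift, ← proj_bLift, ← map_mul]
  congr 1
  ext i j
  fin_cases i <;> fin_cases j <;>
    simp [Matrix.mul_apply, Fin.sum_univ_two, coe_aLift, coe_bLift]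
  rw [mul_left_comm, ← Real.exp_add]
  ring_nf

lemma c_mul_a (u t : ℝ) : c u * a t = a t * c (u * Real.exp t) := by
  simp only [← proj_aLift, ← proj_cLift, ← map_mul]
  congr 1
  ext i j
  fin_cases i <;> fin_cases j <;>
    simp [Matrix.mul_apply, Fin.sum_univ_two, coe_aLift, coe_cLift]
  rw [mul_left_comm, ← Real.exp_add]
  ring_nf

/-- The relative position of two points of the same section. Both the transfer identity and all
distance estimates go through it. -/
lemma mul_unipotents (u s u' s' : ℝ) :
    c u' * b s' = c u * b s * (b (-s) * c (u' - u) * b s') := by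
  rw [show c u' = c u * c (u' - u) by rw [← c_add, add_sub_cancel], b_neg]
  group

lemma exists_smul_eq_of_proj_eq {g h : SL(2, ℝ)} (hgh : proj g = proj h) :
    ∃ r : ℝ, ∀ i j, h.1 i j = g.1 i j * r := by
  have h1 : g⁻¹ * h ∈ Subgroup.center SL(2, ℝ) := QuotientGroup.eq.1 hgh
  obtain ⟨r, -, hr⟩ := Matrix.SpecialLinearGroup.mem_center_iff.1 h1
  refine ⟨r, fun i j => ?_⟩
  have h2 : h = g * (g⁻¹ * h) := by group
  have h3 : h.1 = g.1 * (g⁻¹ * h).1 := by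
    conv_lhs => rw [h2]
    rfl
  rw [h3, ← hr]
  simp

/-- The coordinates `(u, s)` determine and are determined by the element `c u * b s`. -/
lemma coords_eq_of_mul_eq {u s u' s' : ℝ} (h : c u * b s = c u' * b s') : u = u' ∧ s = s' := by
  simp only [← proj_cLift, ← proj_bLift, ← map_mul] at h
  obtain ⟨r, hr⟩ := exists_smul_eq_of_proj_eq h
  -- The upper left entry of both products is 1, so the central scalar `r` is 1.
  have h1 := hr 0 0
  have h2 := hr 0 1
  have h3 := hr 1 0
  simp [Matrix.mul_apply, Fin.sum_univ_two, coe_bLift, coe_cLift] at h1 h2 h3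
  subst h1
  exact ⟨by linarith, by linarith⟩

/-- The conditions on the coordinates under which the frame `c U * b S` is carried to `c u * b s` by
the element of `G` that carries `c u₀ * b s₀` in time `T` to `c u₁ * b s₁`, up to a flow time. -/
lemma transfer_eq {U S u s u₀ s₀ u₁ s₁ T T' l : ℝ} (hl : 0 < l)
    (hl' : l = 1 - (u - u₁) * (s₁ - Real.exp (-T) * s₀))
    (hU : (U - u₀) * l = Real.exp (-T) * (u - u₁))
    (hs₀ : 1 + s * (u - u₁) ≠ 0) (hS₀ : 1 + S * (U - u₀) ≠ 0)
    (hS : s / (1 + s * (u - u₁)) - s₁ = Real.exp (-T) * (S / (1 + S * (U - u₀)) - s₀))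
    (hT' : Real.exp (T' / 2) = Real.exp (T / 2) * l) :
    c U * b S * a T' = c u₀ * b s₀ * a T * (b (-s₁) * c (u - u₁) * b s) := by
  -- After subtracting `u₀` times the upper row, the four entries of the matrix identity are `hl'`,
  -- `hU`, `h12` and this equation. It follows from the hypotheses because `1 - d * (s / (1 + s *
  -- d)) = 1 / (1 + s * d)`.
  have hX : (1 + s * (u - u₁)) * l = 1 + S * (U - u₀) := by
    have ht : 1 - (u - u₁) * (s / (1 + s * (u - u₁))) = 1 / (1 + s * (u - u₁)) := by
      rw [eq_div_iff hs₀, sub_mul, mul_assoc, div_mul_cancel₀ _ hs₀]; ring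
    have h1 : l = 1 / (1 + s * (u - u₁)) + (U - u₀) * l * (S / (1 + S * (U - u₀))) := by
      rw [hU]
      linear_combination hl' + ht + (u - u₁) * hS
    have h2 : l * (1 - (U - u₀) * (S / (1 + S * (U - u₀)))) = 1 / (1 + s * (u - u₁)) := by
      linear_combination h1
    have h3 : 1 - (U - u₀) * (S / (1 + S * (U - u₀))) = 1 / (1 + S * (U - u₀)) := by
      rw [eq_div_iff hS₀, sub_mul, mul_assoc, div_mul_cancel₀ _ hS₀]; ring
    rw [h3] at h2
    field_simp at h2
    linarith
  have h12 : s - s₁ * (1 + s * (u - u₁)) + Real.exp (-T) * s₀ * (1 + s * (u - u₁)) =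
      Real.exp (-T) * (S / l) := by
    have h1 : S / l = (1 + s * (u - u₁)) * (S / (1 + S * (U - u₀))) := by
      rw [← hX]; field_simp
    have h2 : s = (1 + s * (u - u₁)) * (s / (1 + s * (u - u₁))) := by field_simp
    rw [h1]
    linear_combination (1 + s * (u - u₁)) * hS + h2
  simp only [← proj_aLift, ← proj_cLift, ← proj_bLift, ← map_mul]
  congr 1
  have hp := Real.exp_pos (T / 2)
  have hE : Real.exp (-T) = (Real.exp (T / 2))⁻¹ ^ 2 := by
    rw [← Real.exp_neg, ← Real.exp_nat_mul]; congr 1; push_cast; ring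
  have hm : Real.exp (-(T / 2)) = (Real.exp (T / 2))⁻¹ := Real.exp_neg _
  have hm' : Real.exp (-(T' / 2)) = (Real.exp (T / 2) * l)⁻¹ := by rw [Real.exp_neg, hT']
  obtain ⟨p, hpT⟩ : ∃ p, Real.exp (T / 2) = p := ⟨_, rfl⟩
  rw [hpT, mul_inv] at hm'
  rw [hpT] at hp hE hm hT'
  have hpq : p * p⁻¹ = 1 := mul_inv_cancel₀ hp.ne'
  have hlk : l * l⁻¹ = 1 := mul_inv_cancel₀ hl.ne'
  rw [hE] at hl' hU h12
  rw [div_eq_mul_inv] at h12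
  ext i j
  fin_cases i <;> fin_cases j <;>
    simp [Matrix.mul_apply, Fin.sum_univ_two, coe_aLift, coe_bLift, coe_cLift, hT', hm, hm', hpT]
  · linear_combination p * hl' + (u - u₁) * s₀ * p⁻¹ * hpq
  · linear_combination -p * h12 +
      (p⁻¹ * s₀ * (1 + s * (u - u₁)) - p⁻¹ * S * l⁻¹) * hpq
  · linear_combination p * hU + u₀ * p * hl' + ((u - u₁) * p⁻¹ + u₀ * (u - u₁) * s₀ * p⁻¹) * hpq
  · linear_combination -u₀ * p * h12 +
      u₀ * (p⁻¹ * s₀ * (1 + s * (u - u₁)) - p⁻¹ * S * l⁻¹) * hpq -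
      l⁻¹ * p⁻¹ * hX + (1 + s * (u - u₁)) * p⁻¹ * hlk

/-! ### Estimates for the coordinates -/

lemma abs_mul_le_mul {x y X Y : ℝ} (hx : |x| ≤ X) (hy : |y| ≤ Y) : |x * y| ≤ X * Y := by
  rw [abs_mul]
  exact mul_le_mul hx hy (abs_nonneg _) ((abs_nonneg _).trans hx)

/-- Three numbers in `(-r, r)` whose mutual distances are large. -/
lemma sum_lt_of_separated {x₀ x₁ x₂ r δ e₀ e₁ e₂ : ℝ} (h₀ : |x₀| < r) (h₁ : |x₁| < r)
    (h₂ : |x₂| < r) (he₀ : 0 ≤ e₀) (he₁ : 0 ≤ e₁) (he₂ : 0 ≤ e₂)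
    (h₀₁ : δ + e₀ + e₁ < |x₀ - x₁|) (h₁₂ : δ + e₁ + e₂ < |x₁ - x₂|)
    (h₂₀ : δ + e₂ + e₀ < |x₂ - x₀|) : 2 * δ + (e₀ + e₁ + e₂) < 2 * r := by
  -- In each ordering of the three numbers the two gaps between neighbours add up to the largest
  -- gap, which is below `2 * r`.
  rw [abs_lt] at h₀ h₁ h₂
  rcases lt_abs.1 h₀₁ with h | h <;> rcases lt_abs.1 h₁₂ with h' | h' <;>
    rcases lt_abs.1 h₂₀ with h'' | h'' <;> linarith

/-- The maximum is `√2 / 9 ≈ 0.157`, attained at `r = 1 / (6√2) ≈ 0.118`. -/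
lemma two_mul_sub_cube_le {r : ℝ} (hr : 0 ≤ r) : 2 * r - 48 * r ^ 3 ≤ 4 / 25 := by
  nlinarith [mul_nonneg hr (sq_nonneg (r - 0.118)), sq_nonneg (r - 0.118)]

/-- Cyclic compositions of continuous self-maps of an interval have fixed points. -/
lemma exists_cycle {m M : ℝ} (hmM : m ≤ M) (f : Fin 3 → ℝ → ℝ)
    (hf : ∀ i, ContinuousOn (f i) (Set.Icc m M))
    (hm : ∀ i, Set.MapsTo (f i) (Set.Icc m M) (Set.Icc m M)) :
    ∃ x : Fin 3 → ℝ, (∀ i, x i ∈ Set.Icc m M) ∧ ∀ i, x (i + 1) = f i (x i) := by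
  obtain ⟨y, hy, hfix⟩ := exists_mem_Icc_isFixedPt_of_mapsTo
    (f := fun y => f 2 (f 1 (f 0 y)))
    ((hf 2).comp ((hf 1).comp (hf 0) (hm 0)) ((hm 1).comp (hm 0))) hmM
    ((hm 2).comp ((hm 1).comp (hm 0)))
  refine ⟨![y, f 0 y, f 1 (f 0 y)], ?_, ?_⟩
  · intro i
    fin_cases i
    exacts [hy, hm 0 hy, hm 1 (hm 0 hy)]
  · intro i
    fin_cases i
    exacts [rfl, rfl, hfix.symm]

/-! ### Bounds for a single stretch: the unstable step backwards, the stable step forwards -/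

section Step

variable {r E s₀ s₁ : ℝ}

lemma abs_sub_exp_mul_le (hE : 0 ≤ E) (hE' : E ≤ 4 / 25) (hs₀ : |s₀| ≤ r) (hs₁ : |s₁| ≤ r) :
    |s₁ - E * s₀| ≤ 29 / 25 * r := by
  have h : |E * s₀| ≤ 4 / 25 * r := abs_mul_le_mul (by rwa [abs_of_nonneg hE]) hs₀
  linarith [abs_sub s₁ (E * s₀)]

lemma multiplier_bound {d k : ℝ} (hE : 0 ≤ E) (hE' : E ≤ 4 / 25)
    (hs₀ : |s₀| ≤ r) (hs₁ : |s₁| ≤ r) (hd : |d| ≤ k * r) :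
    |d * (s₁ - E * s₀)| ≤ 29 / 25 * k * r ^ 2 := by
  refine (abs_mul_le_mul hd (abs_sub_exp_mul_le hE hE' hs₀ hs₁)).trans (le_of_eq ?_)
  ring

lemma multiplier_ge (hr : r ^ 2 ≤ 1 / 24) (hE : 0 ≤ E) (hE' : E ≤ 4 / 25)
    (hs₀ : |s₀| ≤ r) (hs₁ : |s₁| ≤ r) {d : ℝ} (hd : |d| ≤ 3 * r) :
    0.855 ≤ 1 - d * (s₁ - E * s₀) := by
  have h := abs_le.1 (multiplier_bound hE hE' hs₀ hs₁ hd)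
  norm_num at h ⊢
  linarith [h.2]

lemma unstable_step_bound (hr : r ^ 2 ≤ 1 / 24) (hE : 0 ≤ E) (hE' : E ≤ 4 / 25)
    (hs₀ : |s₀| ≤ r) (hs₁ : |s₁| ≤ r) {d : ℝ} (hd : |d| ≤ 3 * r) :
    |E * d / (1 - d * (s₁ - E * s₀))| ≤ 3.52 * r * E := by
  have h := multiplier_ge hr hE hE' hs₀ hs₁ hd
  have h0 : 0 < 1 - d * (s₁ - E * s₀) := lt_of_lt_of_le (by norm_num) h
  have hr0 : 0 ≤ r := (abs_nonneg _).trans hs₀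
  rw [abs_div, abs_of_pos h0, div_le_iff₀ h0, abs_mul, abs_of_nonneg hE]
  have h1 : E * |d| ≤ E * (3 * r) := mul_le_mul_of_nonneg_left hd hE
  have h2 : 3.52 * r * E * 0.855 ≤ 3.52 * r * E * (1 - d * (s₁ - E * s₀)) :=
    mul_le_mul_of_nonneg_left h (by positivity)
  have h3 := mul_nonneg hr0 hE
  norm_num at h2 ⊢
  linarith

/-- The stable coordinate of the point that reaches, in the time `T` with `E = exp (-T)`, a
point with stable coordinate `S`. -/
def stableStep (E s₀ s₁ d D S : ℝ) : ℝ :=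
  (s₁ + E * (S / (1 + S * D) - s₀)) / (1 - (s₁ + E * (S / (1 + S * D) - s₀)) * d)

/-- All constants are rounded from `r ^ 2 ≤ 1 / 24` and `E ≤ 4 / 25`: for instance `2 * 0.57 / 24 <
0.05`, `2 / 0.95 < 2.11`, `1 + 3.12 * 4 / 25 < 1.5` and `1.5 * 2.6 / 24 < 0.17`. -/
lemma stable_aux {d D S : ℝ} (hr : r ^ 2 ≤ 1 / 24) (hE : 0 ≤ E) (hE' : E ≤ 4 / 25)
    (hs₀ : |s₀| ≤ r) (hs₁ : |s₁| ≤ r) (hd : |d| ≤ 2.6 * r) (hD : |D| ≤ 0.57 * r)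
    (hS : |S| ≤ 2 * r) :
    0.95 ≤ 1 + S * D ∧ |E * (S / (1 + S * D) - s₀)| ≤ 3.12 * r * E ∧
      |s₁ + E * (S / (1 + S * D) - s₀)| ≤ 1.5 * r ∧
      0.83 ≤ 1 - (s₁ + E * (S / (1 + S * D) - s₀)) * d := by
  have hr0 : 0 ≤ r := (abs_nonneg _).trans hs₀
  have h1 : 0.95 ≤ 1 + S * D := by
    have h := abs_le.1 (abs_mul_le_mul hS hD)
    norm_num at h ⊢
    nlinarith [h.1]
  have h1' : 0 < 1 + S * D := lt_of_lt_of_le (by norm_num) h1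
  have h2 : |S / (1 + S * D)| ≤ 2.11 * r := by
    rw [abs_div, abs_of_pos h1', div_le_iff₀ h1']
    have : 2.11 * r * 0.95 ≤ 2.11 * r * (1 + S * D) :=
      mul_le_mul_of_nonneg_left h1 (by positivity)
    norm_num at this ⊢
    linarith
  have h3 : |S / (1 + S * D) - s₀| ≤ 3.12 * r := by
    have := abs_sub (S / (1 + S * D)) s₀
    norm_num at h2 ⊢
    linarith
  have h4 : |E * (S / (1 + S * D) - s₀)| ≤ 3.12 * r * E := by
    rw [abs_mul, abs_of_nonneg hE, mul_comm]
    exact mul_le_mul_of_nonneg_right h3 hE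
  have h5 : |s₁ + E * (S / (1 + S * D) - s₀)| ≤ 1.5 * r := by
    have h6 := abs_add_le s₁ (E * (S / (1 + S * D) - s₀))
    have h7 : 3.12 * r * E ≤ 3.12 * r * (4 / 25) := mul_le_mul_of_nonneg_left hE' (by positivity)
    have h8 : 3.12 * r * (4 / 25) ≤ 0.5 * r := by norm_num; linarith
    have h9 := (h4.trans h7).trans h8
    refine h6.trans ((add_le_add hs₁ h9).trans (le_of_eq ?_))
    norm_num; ring
  refine ⟨h1, h4, h5, ?_⟩
  have h := abs_le.1 (abs_mul_le_mul h5 hd)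
  norm_num at h ⊢
  nlinarith [h.2]

lemma abs_stableStep_le {d D S : ℝ} (hr : r ^ 2 ≤ 1 / 24) (hE : 0 ≤ E) (hE' : E ≤ 4 / 25)
    (hs₀ : |s₀| ≤ r) (hs₁ : |s₁| ≤ r) (hd : |d| ≤ 2.6 * r) (hD : |D| ≤ 0.57 * r)
    (hS : |S| ≤ 2 * r) : |stableStep E s₀ s₁ d D S| ≤ 2 * r := by
  obtain ⟨-, -, h3, h4⟩ := stable_aux hr hE hE' hs₀ hs₁ hd hD hS
  have hr0 : 0 ≤ r := (abs_nonneg _).trans hs₀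
  have h0 := lt_of_lt_of_le (show (0 : ℝ) < 0.83 by norm_num) h4
  rw [stableStep, abs_div, abs_of_pos h0, div_le_iff₀ h0]
  have : 2 * r * 0.83 ≤ 2 * r * (1 - (s₁ + E * (S / (1 + S * D) - s₀)) * d) :=
    mul_le_mul_of_nonneg_left h4 (by positivity)
  norm_num at this h3 ⊢
  linarith

lemma abs_stableStep_sub_le {d D S : ℝ} (hr : r ^ 2 ≤ 1 / 24) (hE : 0 ≤ E) (hE' : E ≤ 4 / 25)
    (hs₀ : |s₀| ≤ r) (hs₁ : |s₁| ≤ r) (hd : |d| ≤ 2.6 * r) (hD : |D| ≤ 0.57 * r)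
    (hS : |S| ≤ 2 * r) :
    |stableStep E s₀ s₁ d D S - s₁| ≤ 7.1 * r ^ 3 + 3.12 * r * E := by
  obtain ⟨-, h2, h3, h4⟩ := stable_aux hr hE hE' hs₀ hs₁ hd hD hS
  rw [stableStep]
  set t := E * (S / (1 + S * D) - s₀)
  have hr0 : 0 ≤ r := (abs_nonneg _).trans hs₀
  have h0 := lt_of_lt_of_le (show (0 : ℝ) < 0.83 by norm_num) h4
  -- The first summand on the right is cubic in `r`, since `s₁ + t` and `d` are both of order `r`;
  -- the second carries the factor `E`.
  have h5 : (s₁ + t) / (1 - (s₁ + t) * d) - s₁ =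
      (s₁ + t) * ((s₁ + t) * d) / (1 - (s₁ + t) * d) + t := by
    rw [div_add' _ _ _ h0.ne', div_sub' h0.ne', div_left_inj' h0.ne']
    ring
  rw [h5]
  refine (abs_add_le _ _).trans (add_le_add ?_ h2)
  rw [abs_div, abs_of_pos h0, div_le_iff₀ h0]
  refine (abs_mul_le_mul h3 (abs_mul_le_mul h3 hd)).trans ?_
  have h6 : 7.1 * r ^ 3 * 0.83 ≤ 7.1 * r ^ 3 * (1 - (s₁ + t) * d) :=
    mul_le_mul_of_nonneg_left h4 (by positivity)
  have h7 : 0 ≤ r ^ 3 := by positivity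
  norm_num at h6 ⊢
  linarith

/-- The map `w ↦ w / (1 - w * d)` inverts `s ↦ s / (1 + s * d)`, so the step solves the stable
equation of `transfer_eq`. -/
lemma one_add_stableStep_mul {d D S : ℝ} (hr : r ^ 2 ≤ 1 / 24) (hE : 0 ≤ E) (hE' : E ≤ 4 / 25)
    (hs₀ : |s₀| ≤ r) (hs₁ : |s₁| ≤ r) (hd : |d| ≤ 2.6 * r) (hD : |D| ≤ 0.57 * r)
    (hS : |S| ≤ 2 * r) : 1 + stableStep E s₀ s₁ d D S * d ≠ 0 ∧
      stableStep E s₀ s₁ d D S / (1 + stableStep E s₀ s₁ d D S * d) - s₁ =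
        E * (S / (1 + S * D) - s₀) := by
  obtain ⟨-, h2, h3, h4⟩ := stable_aux hr hE hE' hs₀ hs₁ hd hD hS
  rw [stableStep]
  set t := E * (S / (1 + S * D) - s₀)
  have h0 := lt_of_lt_of_le (show (0 : ℝ) < 0.83 by norm_num) h4
  have h5 : 1 + (s₁ + t) / (1 - (s₁ + t) * d) * d = 1 / (1 - (s₁ + t) * d) := by
    rw [eq_div_iff h0.ne', add_mul, mul_right_comm, div_mul_cancel₀ _ h0.ne']
    ring
  rw [h5]
  refine ⟨one_div_ne_zero h0.ne', ?_⟩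
  rw [div_div_div_cancel_right₀ h0.ne', div_one, add_sub_cancel_left]

end Step

/-! ### The coordinates of the partner orbit -/

lemma exists_unstable_coords {r : ℝ} (hr0 : 0 ≤ r) (hr : r ^ 2 ≤ 1 / 24) {u s E : Fin 3 → ℝ}
    (hE : ∀ j, 0 ≤ E j) (hE' : ∀ j, E j ≤ 4 / 25) (hu : ∀ j, |u j| ≤ r) (hs : ∀ j, |s j| ≤ r) :
    ∃ u' : Fin 3 → ℝ, ∀ j, |u' (j + 2) - u j| ≤ 3.52 * r * E j ∧
      (u' (j + 2) - u j) * (1 - (u' (j + 1) - u (j + 1)) * (s (j + 1) - E j * s j)) =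
        E j * (u' (j + 1) - u (j + 1)) := by
  -- The search interval has radius `2 * r`: a step lands within `3.52 * (4 / 25) * r` of some `u
  -- i`, hence inside it again.
  have hd : ∀ y ∈ Set.Icc (-(2 * r)) (2 * r), ∀ i, |y - u i| ≤ 3 * r := fun y hy i => by
    have h1 := abs_le.2 hy
    have h2 := hu i
    linarith [abs_sub y (u i)]
  have hb : ∀ y ∈ Set.Icc (-(2 * r)) (2 * r), ∀ i,
      |E (i + 2) * (y - u i) / (1 - (y - u i) * (s i - E (i + 2) * s (i + 2)))| ≤
        3.52 * r * E (i + 2) := fun y hy i =>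
    unstable_step_bound hr (hE _) (hE' _) (hs _) (hs _) (hd y hy i)
  have hpos : ∀ y ∈ Set.Icc (-(2 * r)) (2 * r), ∀ i,
      1 - (y - u i) * (s i - E (i + 2) * s (i + 2)) ≠ 0 := fun y hy i =>
    (lt_of_lt_of_le (by norm_num)
      (multiplier_ge hr (hE _) (hE' _) (hs _) (hs _) (hd y hy i))).ne'
  obtain ⟨x, hx, hxf⟩ := exists_cycle (m := -(2 * r)) (M := 2 * r) (by linarith)
    (fun i y => u (i + 2) +
      E (i + 2) * (y - u i) / (1 - (y - u i) * (s i - E (i + 2) * s (i + 2))))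
    (by
      intro i
      refine continuousOn_const.add (ContinuousOn.div (by fun_prop) (by fun_prop) ?_)
      exact fun y hy => hpos y hy i)
    (by
      intro i y hy
      refine abs_le.1 ?_
      have h1 := hb y hy i
      have h2 := hu (i + 2)
      have h3 : 3.52 * r * E (i + 2) ≤ 3.52 * r * (4 / 25) :=
        mul_le_mul_of_nonneg_left (hE' _) (by positivity)
      refine (abs_add_le _ _).trans ?_
      norm_num at h1 h3 ⊢
      linarith)
  refine ⟨x, fun j => ?_⟩
  have hj : j + 1 + 2 = j := (by decide : ∀ j : Fin 3, j + 1 + 2 = j) j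
  have h1 := hxf (j + 1)
  have h2 := hb (x (j + 1)) (hx _) (j + 1)
  have h3 := hpos (x (j + 1)) (hx _) (j + 1)
  rw [hj] at h2 h3
  rw [add_assoc, hj] at h1
  have h4 : x (j + 2) - u j = E j * (x (j + 1) - u (j + 1)) /
      (1 - (x (j + 1) - u (j + 1)) * (s (j + 1) - E j * s j)) := by
    rw [sub_eq_iff_eq_add']
    exact h1
  refine ⟨by rw [h4]; exact h2, ?_⟩
  rw [h4, div_mul_cancel₀ _ h3]

lemma exists_stable_coords {r : ℝ} (hr0 : 0 ≤ r) (hr : r ^ 2 ≤ 1 / 24) {u u' s E : Fin 3 → ℝ}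
    (hE : ∀ j, 0 ≤ E j) (hE' : ∀ j, E j ≤ 4 / 25) (hs : ∀ j, |s j| ≤ r)
    (hd : ∀ j, |u' j - u j| ≤ 2.6 * r) (hD : ∀ j, |u' (j + 2) - u j| ≤ 0.57 * r) :
    ∃ s' : Fin 3 → ℝ, ∀ j, |s' j| ≤ 2 * r ∧
      |s' (j + 1) - s (j + 1)| ≤ 7.1 * r ^ 3 + 3.12 * r * E j ∧
      1 + s' (j + 1) * (u' (j + 1) - u (j + 1)) ≠ 0 ∧
      1 + s' (j + 2) * (u' (j + 2) - u j) ≠ 0 ∧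
      s' (j + 1) / (1 + s' (j + 1) * (u' (j + 1) - u (j + 1))) - s (j + 1) =
        E j * (s' (j + 2) / (1 + s' (j + 2) * (u' (j + 2) - u j)) - s j) := by
  obtain ⟨x, hx, hxf⟩ := exists_cycle (m := -(2 * r)) (M := 2 * r) (by linarith)
    (fun i => stableStep (E (1 - i)) (s (1 - i)) (s (1 - i + 1)) (u' (1 - i + 1) - u (1 - i + 1))
      (u' (1 - i + 2) - u (1 - i)))
    (by
      intro i
      unfold stableStep
      have h : ∀ S ∈ Set.Icc (-(2 * r)) (2 * r), _ := fun S hS => stable_aux hr (hE (1 - i))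
        (hE' _) (hs (1 - i)) (hs (1 - i + 1)) (hd (1 - i + 1)) (hD (1 - i)) (abs_le.2 hS)
      have h1 : ContinuousOn (fun S => S / (1 + S * (u' (1 - i + 2) - u (1 - i))))
          (Set.Icc (-(2 * r)) (2 * r)) := ContinuousOn.div (by fun_prop) (by fun_prop)
        fun S hS => (lt_of_lt_of_le (by norm_num) (h S hS).1).ne'
      refine ContinuousOn.div (by fun_prop) (by fun_prop) fun S hS => ?_
      exact (lt_of_lt_of_le (by norm_num) (h S hS).2.2.2).ne')
    (by
      intro i S hS
      exact abs_le.1 (abs_stableStep_le hr (hE _) (hE' _) (hs _) (hs _) (hd _) (hD _)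
        (abs_le.2 hS)))
  -- The stable coordinate at `j + 1` is computed from the one at `j + 2`, so the cycle runs through
  -- the indices downwards, opposite to the unstable one.
  refine ⟨fun j => x (-j), fun j => ?_⟩
  have hS := abs_le.2 (hx (-(j + 2)))
  have h1 := hxf (1 - j)
  have h2 : ∀ j : Fin 3, 1 - j + 1 = -(j + 1) := by decide
  have h3 : ∀ j : Fin 3, 1 - (1 - j) = j := by decide
  have h4 : ∀ j : Fin 3, 1 - j = -(j + 2) := by decide
  rw [h2, h3, h4] at h1
  have h5 := stable_aux hr (hE j) (hE' j) (hs j) (hs (j + 1)) (hd (j + 1)) (hD j) hS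
  have h6 := abs_stableStep_sub_le hr (hE j) (hE' j) (hs j) (hs (j + 1)) (hd (j + 1)) (hD j) hS
  have h7 := one_add_stableStep_mul hr (hE j) (hE' j) (hs j) (hs (j + 1)) (hd (j + 1)) (hD j) hS
  rw [← h1] at h6 h7
  exact ⟨abs_le.2 (hx _), h6, h7.1, (lt_of_lt_of_le (by norm_num) h5.1).ne', h7.2⟩

lemma abs_log_one_add_sub_le {x : ℝ} (hx : |x| ≤ 1 / 2) : |Real.log (1 + x) - x| ≤ 2 * x ^ 2 := by
  have h := Real.abs_log_sub_add_sum_range_le (x := -x) (by rw [abs_neg]; linarith) 1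
  simp only [Finset.sum_range_one, abs_neg, sub_neg_eq_add] at h
  norm_num at h
  rw [sub_eq_neg_add]
  refine h.trans ?_
  rw [div_le_iff₀ (by linarith)]
  nlinarith [sq_nonneg x]

lemma exists_partner_coords {r : ℝ} (hr0 : 0 ≤ r) (hr : r ^ 2 ≤ 1 / 24) {u s E : Fin 3 → ℝ}
    (hE : ∀ j, 0 ≤ E j) (hE' : ∀ j, E j ≤ 4 / 25) (hu : ∀ j, |u j| ≤ r) (hs : ∀ j, |s j| ≤ r) :
    ∃ u' s' l : Fin 3 → ℝ,
      (∀ j, l j = 1 - (u' (j + 1) - u (j + 1)) * (s (j + 1) - E j * s j)) ∧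
      (∀ j, |l j - 1| ≤ 3.02 * r ^ 2) ∧
      (∀ j, (u' (j + 2) - u j) * l j = E j * (u' (j + 1) - u (j + 1))) ∧
      (∀ j, |u' j - u (j + 1)| ≤ 3.52 * r * E (j + 1)) ∧
      (∀ j, |u' j - u j| ≤ 2.6 * r) ∧ (∀ j, |u' j| ≤ 2 * r) ∧ (∀ j, |s' j| ≤ 2 * r) ∧
      (∀ j, |s' j - s j| ≤ 7.1 * r ^ 3 + 3.12 * r * E (j - 1)) ∧
      (∀ j, 1 + s' (j + 1) * (u' (j + 1) - u (j + 1)) ≠ 0) ∧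
      (∀ j, 1 + s' (j + 2) * (u' (j + 2) - u j) ≠ 0) ∧
      ∀ j, s' (j + 1) / (1 + s' (j + 1) * (u' (j + 1) - u (j + 1))) - s (j + 1) =
        E j * (s' (j + 2) / (1 + s' (j + 2) * (u' (j + 2) - u j)) - s j) := by
  obtain ⟨u', hu'⟩ := exists_unstable_coords hr0 hr hE hE' hu hs
  have i1 : ∀ j : Fin 3, j + 1 + 2 = j := by decide
  have i2 : ∀ j : Fin 3, j - 1 + 1 = j := by decide
  have hD : ∀ j, |u' (j + 2) - u j| ≤ 0.57 * r := fun j => by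
    refine (hu' j).1.trans ?_
    have h : 3.52 * r * E j ≤ 3.52 * r * (4 / 25) :=
      mul_le_mul_of_nonneg_left (hE' _) (by positivity)
    norm_num at h ⊢
    linarith
  have hD' : ∀ j, |u' j - u (j + 1)| ≤ 0.57 * r := fun j => by simpa only [i1] using hD (j + 1)
  have hd : ∀ j, |u' j - u j| ≤ 2.6 * r := fun j => by
    have h1 := abs_sub_le (u' j) (u (j + 1)) (u j)
    have h2 := abs_sub (u (j + 1)) (u j)
    have h3 := hD' j
    norm_num at h3 ⊢
    linarith [hu j, hu (j + 1)]
  obtain ⟨s', hs'⟩ := exists_stable_coords hr0 hr hE hE' hs hd hD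
  refine ⟨u', s', fun j => 1 - (u' (j + 1) - u (j + 1)) * (s (j + 1) - E j * s j),
    fun j => rfl, fun j => ?_, fun j => (hu' j).2, fun j => ?_, hd, fun j => ?_,
    fun j => (hs' j).1, fun j => ?_, fun j => (hs' j).2.2.1, fun j => (hs' j).2.2.2.1,
    fun j => (hs' j).2.2.2.2⟩
  · have h := multiplier_bound (hE j) (hE' j) (hs j) (hs (j + 1)) (hd (j + 1))
    rw [show ∀ x : ℝ, 1 - x - 1 = -x by intro x; ring, abs_neg]
    refine h.trans ?_
    norm_num
    linarith [sq_nonneg r]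
  · simpa only [i1] using (hu' (j + 1)).1
  · have h1 := abs_sub_abs_le_abs_sub (u' j) (u (j + 1))
    have h3 := hD' j
    norm_num at h3
    linarith [hu (j + 1)]
  · simpa only [i2] using (hs' (j - 1)).2.1

/-- Every logarithm is replaced by its linear part, at a total cost of `(3 * 18.3 + 2 * 32) * r ^
4`. The linear parts agree up to terms with a factor `E j`, each with coefficient at most `(3.52 +
2.6) * r ^ 2`. -/
lemma action_estimate {r : ℝ} (hr : r ^ 2 ≤ 1 / 24) {u s E u' l : Fin 3 → ℝ}
    (hE : ∀ j, 0 ≤ E j) (hu : ∀ j, |u j| ≤ r) (hs : ∀ j, |s j| ≤ r)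
    (hl : ∀ j, l j = 1 - (u' (j + 1) - u (j + 1)) * (s (j + 1) - E j * s j))
    (hl' : ∀ j, |l j - 1| ≤ 3.02 * r ^ 2)
    (hu₁ : ∀ j, |u' j - u (j + 1)| ≤ 3.52 * r * E (j + 1)) (hu₂ : ∀ j, |u' j - u j| ≤ 2.6 * r) :
    |Real.log (l 0) + Real.log (l 1) + Real.log (l 2) -
        (Real.log (1 + (u 2 - u 0) * (s 2 - s 1)) + Real.log (1 + (u 1 - u 0) * (s 1 - s 0)))| ≤
      120 * r ^ 4 + 7 * r ^ 2 * (E 0 + E 1 + E 2) := by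
  have hlog : ∀ j, |Real.log (l j) - (l j - 1)| ≤ 18.3 * r ^ 4 := fun j => by
    have h1 := hl' j
    have h2 := abs_log_one_add_sub_le (x := l j - 1) (by norm_num at h1 ⊢; linarith)
    rw [add_sub_cancel] at h2
    refine h2.trans ?_
    have h3 : (l j - 1) ^ 2 ≤ (3.02 * r ^ 2) ^ 2 := by
      rw [← sq_abs]
      exact pow_le_pow_left₀ (abs_nonneg _) h1 2
    have h4 : 0 ≤ r ^ 4 := by positivity
    norm_num [mul_pow] at h3 ⊢
    rw [← pow_mul] at h3
    norm_num at h3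
    linarith
  have hlog' : ∀ i j k m, |Real.log (1 + (u i - u j) * (s k - s m)) - (u i - u j) * (s k - s m)| ≤
      32 * r ^ 4 := fun i j k m => by
    have h1 : |(u i - u j) * (s k - s m)| ≤ (2 * r) * (2 * r) := by
      refine abs_mul_le_mul ?_ ?_
      · linarith [abs_sub (u i) (u j), hu i, hu j]
      · linarith [abs_sub (s k) (s m), hs k, hs m]
    refine (abs_log_one_add_sub_le (by nlinarith)).trans ?_
    have h3 : ((u i - u j) * (s k - s m)) ^ 2 ≤ ((2 * r) * (2 * r)) ^ 2 := by
      rw [← sq_abs]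
      exact pow_le_pow_left₀ (abs_nonneg _) h1 2
    nlinarith
  have herr₁ : ∀ j, |(u' j - u (j + 1)) * s j| ≤ 3.52 * r ^ 2 * E (j + 1) := fun j =>
    (abs_mul_le_mul (hu₁ j) (hs j)).trans (le_of_eq (by ring))
  have herr₂ : ∀ j, |(u' (j + 1) - u (j + 1)) * (E j * s j)| ≤ 2.6 * r ^ 2 * E j := fun j => by
    have h : |E j * s j| ≤ E j * r := abs_mul_le_mul (by rw [abs_of_nonneg (hE j)]) (hs j)
    exact (abs_mul_le_mul (hu₂ _) h).trans (le_of_eq (by ring))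
  -- Summation by parts: with `u' j` replaced by `u (j + 1)` and the `E` terms dropped, the left
  -- side vanishes.
  have hlin : (l 0 - 1) + (l 1 - 1) + (l 2 - 1) -
      ((u 2 - u 0) * (s 2 - s 1) + (u 1 - u 0) * (s 1 - s 0)) =
      -((u' 0 - u 1) * s 0) - (u' 1 - u 2) * s 1 - (u' 2 - u 0) * s 2 +
      (u' 1 - u 1) * (E 0 * s 0) + (u' 2 - u 2) * (E 1 * s 1) + (u' 0 - u 0) * (E 2 * s 2) := by
    have h0 := hl 0
    have h1 := hl 1
    have h2 := hl 2
    rw [show (0 : Fin 3) + 1 = 1 from rfl] at h0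
    rw [show (1 : Fin 3) + 1 = 2 from rfl] at h1
    rw [show (2 : Fin 3) + 1 = 0 from rfl] at h2
    rw [h0, h1, h2]
    ring
  have a0 := abs_le.1 (hlog 0)
  have a1 := abs_le.1 (hlog 1)
  have a2 := abs_le.1 (hlog 2)
  have b0 := abs_le.1 (hlog' 2 0 2 1)
  have b1 := abs_le.1 (hlog' 1 0 1 0)
  have c0 := abs_le.1 (herr₁ 0)
  have c1 := abs_le.1 (herr₁ 1)
  have c2 := abs_le.1 (herr₁ 2)
  have d0 := abs_le.1 (herr₂ 0)
  have d1 := abs_le.1 (herr₂ 1)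
  have d2 := abs_le.1 (herr₂ 2)
  have h4 : 0 ≤ r ^ 4 := by positivity
  have hE2 : ∀ j, 0 ≤ r ^ 2 * E j := fun j => mul_nonneg (sq_nonneg r) (hE j)
  have e0 := hE2 0
  have e1 := hE2 1
  have e2 := hE2 2
  rw [show (0 : Fin 3) + 1 = 1 from rfl] at c0 d0
  rw [show (1 : Fin 3) + 1 = 2 from rfl] at c1 d1
  rw [show (2 : Fin 3) + 1 = 0 from rfl] at c2 d2
  norm_num at a0 a1 a2 c0 c1 c2 d0 d1 d2
  rw [abs_le]
  constructor <;> linarith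

/-! ### Points and orbits of the quotient -/

variable (Γ : Subgroup G)

lemma rightMul_mk (g h : G) : rightMul Γ h (mk Γ g) = mk Γ (g * h) := rfl

lemma rightMul_rightMul (h k : G) (x : X Γ) :
    rightMul Γ k (rightMul Γ h x) = rightMul Γ (h * k) x := by
  induction x using Quotient.inductionOn with
  | h g => exact congrArg (mk Γ) (mul_assoc g h k)

lemma flow_flow (t t' : ℝ) (x : X Γ) : flow Γ t' (flow Γ t x) = flow Γ (t + t') x := by
  rw [flow, flow, flow, rightMul_rightMul, a_add]

lemma mk_eq_mk {g h : G} (hgh : mk Γ g = mk Γ h) : ∃ γ ∈ Γ, γ * g = h :=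
  ⟨h * g⁻¹, QuotientGroup.rightRel_apply.1 (Quotient.exact hgh), by group⟩

/-- The point with coordinates `(u, s)` relative to `x`. -/
def point (x : X Γ) (u s : ℝ) : X Γ := rightMul Γ (c u * b s) x

lemma hasCoords_point {ε : ℝ} {x : X Γ} {u s : ℝ} (hu : |u| < ε) (hs : |s| < ε) :
    HasCoords Γ ε x (point Γ x u s) u s := by
  refine ⟨hu, hs, ?_⟩
  induction x using Quotient.inductionOn with
  | h g => exact ⟨g, rfl, congrArg (mk Γ) (mul_assoc _ _ _).symm⟩

lemma HasCoords.eq_point {ε : ℝ} {x y : X Γ} {u s : ℝ} (h : HasCoords Γ ε x y u s) :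
    y = point Γ x u s := by
  obtain ⟨-, -, g, rfl, rfl⟩ := h
  rw [point, rightMul_mk, mul_assoc]

lemma mem_orbit_self (x : X Γ) : x ∈ orbit Γ x := by
  refine ⟨0, ?_⟩
  induction x using Quotient.inductionOn with
  | h g => exact congrArg (mk Γ) (show g * a 0 = g by rw [a_zero, mul_one])

/-- By `hx`, right translation by `c u₀ * b s₀ * a T * (c u₁ * b s₁)⁻¹` fixes `x`; inserting this
element turns the matrix identity into a flow relation on the quotient. -/
lemma flow_point_eq {x : X Γ} {U S u s u₀ s₀ u₁ s₁ T T' l : ℝ} (hl : 0 < l)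
    (hl' : l = 1 - (u - u₁) * (s₁ - Real.exp (-T) * s₀))
    (hU : (U - u₀) * l = Real.exp (-T) * (u - u₁))
    (hs₀ : 1 + s * (u - u₁) ≠ 0) (hS₀ : 1 + S * (U - u₀) ≠ 0)
    (hS : s / (1 + s * (u - u₁)) - s₁ = Real.exp (-T) * (S / (1 + S * (U - u₀)) - s₀))
    (hT' : T' = T + 2 * Real.log l)
    (hx : flow Γ T (point Γ x u₀ s₀) = point Γ x u₁ s₁) :
    flow Γ T' (point Γ x U S) = point Γ x u s := by
  have hT'' : Real.exp (T' / 2) = Real.exp (T / 2) * l := by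
    rw [hT', show (T + 2 * Real.log l) / 2 = T / 2 + Real.log l by ring, Real.exp_add,
      Real.exp_log hl]
  have h := transfer_eq hl hl' hU hs₀ hS₀ hS hT''
  have hx' : rightMul Γ (c u₀ * b s₀ * a T) x = point Γ x u₁ s₁ := by
    rw [← hx, flow, point, rightMul_rightMul]
  rw [flow, point, rightMul_rightMul, h, ← rightMul_rightMul Γ (c u₀ * b s₀ * a T), hx', point,
    point, rightMul_rightMul, ← mul_unipotents]

lemma distX_flow_point_le {x : X Γ} {U S u s t A B C : ℝ} (hS : |S * Real.exp (-t)| ≤ A)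
    (hu : |(u - U) * Real.exp t| ≤ B) (hs : |s * Real.exp (-t)| ≤ C) :
    distX Γ (flow Γ t (point Γ x U S)) (flow Γ t (point Γ x u s)) ≤
      3 / 2 * (A * B * (1 + B * C) + B * C) + (C + B * C ^ 2 + A * (1 + B * C) ^ 2) +
        (B + A * B ^ 2) := by
  induction x using Quotient.inductionOn with
  | h g =>
    change distX Γ (mk Γ (g * (c U * b S) * a t)) (mk Γ (g * (c u * b s) * a t)) ≤ _
    refine (distX_mk_le Γ _ _).trans ?_
    -- Conjugation by `a t` contracts the stable factors by `exp (-t)` and expands the unstable one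
    -- by `exp t`.
    have h : g * (c u * b s) * a t = g * (c U * b S) * a t *
        (b (-S * Real.exp (-t)) * c ((u - U) * Real.exp t) * b (s * Real.exp (-t))) := by
      have h1 : b (-S) * c (u - U) * b s * a t = a t *
          (b (-S * Real.exp (-t)) * c ((u - U) * Real.exp t) * b (s * Real.exp (-t))) := by
        rw [mul_assoc _ (b s), b_mul_a, ← mul_assoc, mul_assoc _ (c _) (a t), c_mul_a,
          ← mul_assoc, b_mul_a]
        simp only [mul_assoc]
      rw [mul_unipotents U S u s, mul_assoc _ (a t), ← h1]
      simp only [mul_assoc]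
    rw [h]
    exact distG_mul_unipotents_le _ (by rwa [neg_mul, abs_neg]) hu hs

/-- Different coordinates give different points if `Γ` displaces every point far enough. -/
lemma point_ne_point {x : X Γ} {U S u s A B C σ : ℝ} (hne : (U, S) ≠ (u, s))
    (hσ : ∀ γ ∈ Γ, γ ≠ 1 → ∀ g : G, σ ≤ distG g (γ * g)) (hS : |S| ≤ A) (hu : |u - U| ≤ B)
    (hs : |s| ≤ C)
    (hlt : 3 / 2 * (A * B * (1 + B * C) + B * C) + (C + B * C ^ 2 + A * (1 + B * C) ^ 2) +
        (B + A * B ^ 2) < σ) : point Γ x U S ≠ point Γ x u s := by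
  induction x using Quotient.inductionOn with
  | h g =>
    intro h
    change mk Γ (g * (c U * b S)) = mk Γ (g * (c u * b s)) at h
    obtain ⟨γ, hγ, hγg⟩ := mk_eq_mk Γ h
    by_cases h1 : γ = 1
    · rw [h1, one_mul, mul_right_inj] at hγg
      obtain ⟨rfl, rfl⟩ := coords_eq_of_mul_eq hγg
      exact hne rfl
    · have h2 := hσ γ hγ h1 (g * (c U * b S))
      rw [hγg, mul_unipotents U S u s, ← mul_assoc g (c U * b S)] at h2
      exact absurd (h2.trans (distG_mul_unipotents_le _ (by rwa [abs_neg]) hu hs)) hlt.not_ge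

/-- These make the polynomial bounds below linear in `r`; 41/200 is a rational upper bound for
`√(1/24)`. -/
lemma pow_bounds {r : ℝ} (hr0 : 0 < r) (hr : r ^ 2 ≤ 1 / 24) :
    r ^ 2 ≤ 41 / 200 * r ∧ r ^ 3 ≤ r / 24 ∧ r ^ 4 ≤ 41 / 4800 * r ∧ r ^ 5 ≤ r / 576 := by
  have h0 : r ≤ 41 / 200 := by nlinarith
  have h2 : r ^ 2 ≤ 41 / 200 * r := by nlinarith
  have h3 : r ^ 3 ≤ r / 24 := by
    calc r ^ 3 = r * r ^ 2 := by ring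
      _ ≤ r * (1 / 24) := mul_le_mul_of_nonneg_left hr hr0.le
      _ = r / 24 := by ring
  refine ⟨h2, h3, ?_, ?_⟩
  · calc r ^ 4 = r ^ 2 * r ^ 2 := by ring
      _ ≤ 41 / 200 * r * (1 / 24) := mul_le_mul h2 hr (sq_nonneg r) (by positivity)
      _ = 41 / 4800 * r := by ring
  · calc r ^ 5 = r ^ 3 * r ^ 2 := by ring
      _ ≤ r / 24 * (1 / 24) := mul_le_mul h3 hr (sq_nonneg r) (by positivity)
      _ = r / 576 := by ring

lemma shadowing_bound {r : ℝ} (hr0 : 0 < r) (hr : r ^ 2 ≤ 1 / 24) :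
    3 / 2 * (2 * r * (4.6 * r) * (1 + 4.6 * r * r) + 4.6 * r * r) +
      (r + 4.6 * r * r ^ 2 + 2 * r * (1 + 4.6 * r * r) ^ 2) + (4.6 * r + 2 * r * (4.6 * r) ^ 2) <
      10 * (3 * r) := by
  obtain ⟨h2, h3, h4, h5⟩ := pow_bounds hr0 hr
  norm_num
  ring_nf
  linarith

lemma separation_bound {r : ℝ} (hr0 : 0 < r) (hr : r ^ 2 ≤ 1 / 24) :
    3 / 2 * (2 * r * (3 * r) * (1 + 3 * r * r) + 3 * r * r) +
      (r + 3 * r * r ^ 2 + 2 * r * (1 + 3 * r * r) ^ 2) + (3 * r + 2 * r * (3 * r) ^ 2) <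
      4 * (3 * r) := by
  obtain ⟨h2, h3, h4, h5⟩ := pow_bounds hr0 hr
  ring_nf
  linarith

end HypFlow

end

/-! ### The partner orbit of a parallel 3-encounter -/

open HypFlow in
theorem theorem3p7 (Γ : Subgroup G) (hdisc : DiscreteTopology Γ) (hcomp : CompactSpace (X Γ))
    (εstar : ℝ) (hεstar : IsCoincidenceConstant Γ εstar)
    (ε : ℝ) (hε0 : 0 < ε) (hε : ε < εstar / 11)
    (C : Set (X Γ)) (T : ℝ) (hC : IsPeriodicOrbit Γ C T)
    (x₀ : X Γ) (x : Fin 3 → X Γ) (u s τ : Fin 3 → ℝ)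
    (hxC : ∀ j, x j ∈ C)
    (hx : ∀ j, HasCoords Γ (ε / 3) x₀ (x j) (u j) (s j))
    (hτ : ∀ j, 0 < τ j) (hT : T = τ 0 + τ 1 + τ 2)
    (hflow₁ : flow Γ (τ 0) (x 0) = x 1)
    (hflow₂ : flow Γ (τ 1) (x 1) = x 2)
    (hflow₃ : flow Γ (τ 2) (x 2) = x 0)
    -- indices in `Fin 3` are cyclic: `j - 1` is the predecessor and `j + 1` the successor of `j`
    (hu : ∀ j i, j ≠ i → 6 / 5 * (Real.exp (-τ j) + Real.exp (-τ i)) < |u j - u i|)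
    (hs : ∀ j i, j ≠ i →
      24 / 3 ^ 3 * ε ^ 3 + Real.exp (-τ (j - 1)) + Real.exp (-τ (i - 1)) < |s j - s i|) :
    ∃ (C' : Set (X Γ)) (T' : ℝ),
      IsPartnerOrbit Γ (11 * ε) C T C' T' ∧
      |(T' - T) / 2 - (Real.log (1 + (u 2 - u 0) * (s 2 - s 1)) +
          Real.log (1 + (u 1 - u 0) * (s 1 - s 0)))|
        < 76 * ε ^ 4 + 22 * ε ^ 2 * Real.exp (-τ 0) + 7 * ε ^ 2 * Real.exp (-τ 1) +
          7 * ε ^ 2 * Real.exp (-τ 2) ∧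
      HasParallelEncounter Γ 3 ε C' ∧
      ∃ (v : Fin 3 → X Γ) (u' s' τ' : Fin 3 → ℝ),
        (∀ j, v j ∈ C') ∧ (∀ j, 0 < τ' j) ∧
        flow Γ (τ' 1) (v 0) = v 2 ∧ flow Γ (τ' 2) (v 1) = v 0 ∧ flow Γ (τ' 0) (v 2) = v 1 ∧
        T' = τ' 0 + τ' 1 + τ' 2 ∧
        (∀ j, HasCoords Γ ε x₀ (v j) (u' j) (s' j)) ∧
        (∀ j, |u' j - u (j + 1)| < 23 * ε ^ 3 +
          6 * ε * (Real.exp (-τ 0) + Real.exp (-τ 1) + Real.exp (-τ 2))) ∧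
        (∀ j, |s' j - s j| < 23 * ε ^ 3 +
          6 * ε * (Real.exp (-τ 0) + Real.exp (-τ 1) + Real.exp (-τ 2))) ∧
        (∀ j, |τ' j - τ j| < 22 * ε ^ 2) ∧
        (∀ j, ∀ t ∈ Set.Icc 0 (max (τ (j + 1)) (τ' (j + 1))),
          distX Γ (flow Γ t (v j)) (flow Γ t (x (j + 1))) < 10 * ε) ∧
        -- distinction of the partner from the original orbit and from its time reversal
        (∀ j i, (u' j, s' j) ≠ (u i, s i)) ∧
        (∀ σ₀ : ℝ, 4 * ε < σ₀ → (∀ γ ∈ Γ, γ ≠ 1 → ∀ g : G, σ₀ ≤ distG g (γ * g)) →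
          (∀ j i, v j ≠ x i) ∧
          (C ∩ poincareSection Γ ε x₀ ⊆ Set.range x → C' ≠ C) ∧
          (timeRev Γ '' C ∩ poincareSection Γ ε x₀ ⊆ Set.range x → C' ≠ timeRev Γ '' C)) := by

  obtain ⟨r, rfl⟩ : ∃ r, ε = 3 * r := ⟨ε / 3, by ring⟩
  have h3r : 3 * r / 3 = r := by ring
  rw [h3r] at hx
  have hr0 : 0 < r := by linarith
  have hE : ∀ j, 0 ≤ Real.exp (-τ j) := fun j => (Real.exp_pos _).le
  have hur : ∀ j, |u j| < r := fun j => (hx j).1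
  have hsr : ∀ j, |s j| < r := fun j => (hx j).2.1
  have hx' : ∀ j, x j = point Γ x₀ (u j) (s j) := fun j => (hx j).eq_point Γ
  have hsum : 2 * (24 * r ^ 3) + (Real.exp (-τ 2) + Real.exp (-τ 0) + Real.exp (-τ 1)) < 2 * r := by
    have h01 := hs 0 1 (by decide)
    have h12 := hs 1 2 (by decide)
    have h20 := hs 2 0 (by decide)
    rw [show (0 : Fin 3) - 1 = 2 from rfl, show (1 : Fin 3) - 1 = 0 from rfl] at h01
    rw [show (1 : Fin 3) - 1 = 0 from rfl, show (2 : Fin 3) - 1 = 1 from rfl] at h12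
    rw [show (2 : Fin 3) - 1 = 1 from rfl, show (0 : Fin 3) - 1 = 2 from rfl] at h20
    have h3 : 24 / 3 ^ 3 * (3 * r) ^ 3 = 24 * r ^ 3 := by ring
    rw [h3] at h01 h12 h20
    exact sum_lt_of_separated (hsr 0) (hsr 1) (hsr 2) (hE _) (hE _) (hE _) h01 h12 h20
  -- Dropping the exponentials from `hsum` leaves `48 * r ^ 3 < 2 * r`; keeping them gives `hE'`
  -- through `two_mul_sub_cube_le`.
  have hr : r ^ 2 ≤ 1 / 24 := by
    have h1 : r * (48 * r ^ 2) < r * 2 := by linarith [hE 0, hE 1, hE 2]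
    linarith [lt_of_mul_lt_mul_left h1 hr0.le]
  have hr' : r ≤ 0.205 := by norm_num; nlinarith
  have hE' : ∀ j, Real.exp (-τ j) ≤ 4 / 25 := by
    have h := two_mul_sub_cube_le hr0.le
    have h0 := hE 0
    have h1 := hE 1
    have h2 := hE 2
    intro j
    fin_cases j <;> simp only [Fin.zero_eta, Fin.mk_one, Fin.reduceFinMk] <;> linarith
  obtain ⟨u', s', l, hl, hl1, hU, hu₁, hu₂, hu₃, hs₁, hs₂, hn₁, hn₂, hS⟩ :=
    exists_partner_coords hr0.le hr hE hE' (fun j => (hur j).le) (fun j => (hsr j).le)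
  have hl2 : ∀ j, |l j - 1| ≤ 0.126 := fun j => by
    refine (hl1 j).trans ?_
    norm_num
    linarith
  have hlpos : ∀ j, 0 < l j := fun j => by
    have h := (abs_le.1 (hl2 j)).1
    norm_num at h
    linarith
  have hflow : ∀ j, flow Γ (τ j) (x j) = x (j + 1) := by
    intro j
    fin_cases j
    exacts [hflow₁, hflow₂, hflow₃]
  obtain ⟨τ', hτ'⟩ : ∃ τ' : Fin 3 → ℝ, ∀ j, τ' j = τ j + 2 * Real.log (l j) :=
    ⟨_, fun j => rfl⟩
  obtain ⟨v, hv⟩ : ∃ v : Fin 3 → X Γ, ∀ j, v j = point Γ x₀ (u' j) (s' j) := ⟨_, fun j => rfl⟩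
  have hflow' : ∀ j, flow Γ (τ' j) (v (j + 2)) = v (j + 1) := fun j => by
    rw [hv, hv]
    refine flow_point_eq Γ (hlpos j) (hl j) (hU j) (hn₁ j) (hn₂ j) (hS j) (hτ' j) ?_
    rw [← hx', ← hx', hflow]
  have hlog : ∀ j, |Real.log (l j)| ≤ 10 * r ^ 2 := fun j => by
    have h1 := hl2 j
    have h2 := abs_log_one_add_sub_le (x := l j - 1) (by norm_num at h1 ⊢; linarith)
    rw [add_sub_cancel] at h2
    have h3 : 2 * (l j - 1) ^ 2 ≤ |l j - 1| := by
      rw [← sq_abs]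
      norm_num at h1
      nlinarith [abs_nonneg (l j - 1)]
    have h4 := abs_sub_abs_le_abs_sub (Real.log (l j)) (l j - 1)
    have h5 := hl1 j
    norm_num at h5
    linarith [sq_nonneg r]
  have hexp : ∀ j, Real.exp (τ' j) = Real.exp (τ j) * l j ^ 2 := fun j => by
    rw [hτ', Real.exp_add, two_mul, Real.exp_add, Real.exp_log (hlpos j), sq]
  -- Here `exp (τ j) ≥ 25 / 4`, which outweighs `l j ^ 2 ≥ 0.874 ^ 2`.
  have hτ'pos : ∀ j, 0 < τ' j := fun j => by
    rw [← Real.one_lt_exp_iff, hexp]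
    have h1 : 1 ≤ Real.exp (τ j) * (4 / 25) := by
      calc 1 = Real.exp (τ j) * Real.exp (-τ j) := by rw [← Real.exp_add]; simp
        _ ≤ _ := mul_le_mul_of_nonneg_left (hE' j) (Real.exp_pos _).le
    have h2 := (abs_le.1 (hl2 j)).1
    norm_num at h2
    have h3 : (437 / 500 : ℝ) ^ 2 ≤ l j ^ 2 := pow_le_pow_left₀ (by norm_num) (by linarith) 2
    nlinarith [Real.exp_pos (τ j)]
  have hdist : ∀ j, ∀ t ∈ Set.Icc 0 (max (τ (j + 1)) (τ' (j + 1))),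
      distX Γ (flow Γ t (v j)) (flow Γ t (x (j + 1))) < 10 * (3 * r) := fun j t ht => by
    -- The factor 1.3 covers the case where the new stretch is the longer one, as `l ^ 2 ≤ 1.126 ^
    -- 2`. It cancels the `exp (-τ (j + 1))` in `hu₁`, leaving `3.52 * 1.3 * r ≤ 4.6 * r`.
    have h1 : Real.exp t ≤ 1.3 * Real.exp (τ (j + 1)) := by
      have hp := Real.exp_pos (τ (j + 1))
      rcases le_max_iff.1 ht.2 with h | h
      · have := Real.exp_le_exp.2 h
        norm_num
        linarith
      · refine (Real.exp_le_exp.2 h).trans ?_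
        rw [hexp, mul_comm]
        refine mul_le_mul_of_nonneg_right ?_ hp.le
        have h2 := (abs_le.1 (hl2 (j + 1))).2
        norm_num at h2 ⊢
        nlinarith [hlpos (j + 1)]
    have h2 : |Real.exp (-t)| ≤ 1 := by
      rw [abs_of_pos (Real.exp_pos _), Real.exp_le_one_iff]
      linarith [ht.1]
    have h3 : |(u (j + 1) - u' j) * Real.exp t| ≤ 4.6 * r := by
      have h4 : |u (j + 1) - u' j| ≤ 3.52 * r * Real.exp (-τ (j + 1)) := by
        rw [abs_sub_comm]; exact hu₁ j
      have h5 : |Real.exp t| ≤ 1.3 * Real.exp (τ (j + 1)) := by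
        rwa [abs_of_pos (Real.exp_pos _)]
      have h6 : Real.exp (-τ (j + 1)) * Real.exp (τ (j + 1)) = 1 := by
        rw [← Real.exp_add]; simp
      refine (abs_mul_le_mul h4 h5).trans ?_
      rw [show ∀ p q : ℝ, 3.52 * r * p * (1.3 * q) = 3.52 * r * 1.3 * (p * q) by intros; ring, h6]
      norm_num
      linarith
    rw [hv, hx']
    have h7 := distX_flow_point_le Γ (x := x₀) (abs_mul_le_mul (hs₁ j) h2) h3
      (abs_mul_le_mul (hsr (j + 1)).le h2)
    rw [mul_one, mul_one] at h7
    exact h7.trans_lt (shadowing_bound hr0 hr)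
  have hsep : ∀ j i, (u' j, s' j) ≠ (u i, s i) := fun j i h => by
    obtain ⟨h1, h2⟩ := Prod.mk.inj h
    have hbu := hu₁ j
    have hbs := hs₂ j
    rw [h1] at hbu
    rw [h2] at hbs
    have hp := Real.exp_pos (-τ (j + 1))
    have hp' := Real.exp_pos (-τ (j - 1))
    -- A coincidence would put `u i` too close to `u (j + 1)` and `s i` too close to `s j`. Since `j
    -- + 1 ≠ j`, at least one of these contradicts the separation hypotheses.
    by_cases hij : i = j + 1
    · have hij' : i ≠ j := by
        rw [hij]
        exact (by decide : ∀ j : Fin 3, j + 1 ≠ j) j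
      have h3 := hs i j hij'
      have h4 : 3.12 * r * Real.exp (-τ (j - 1)) ≤ 1 * Real.exp (-τ (j - 1)) :=
        mul_le_mul_of_nonneg_right (by norm_num at hr' ⊢; linarith) hp'.le
      have h5 : 24 / 3 ^ 3 * (3 * r) ^ 3 = 24 * r ^ 3 := by ring
      have h6 : 0 < r ^ 3 := by positivity
      have h7 := Real.exp_pos (-τ (i - 1))
      norm_num at hbs h3 h4 h5
      linarith
    · have h3 := hu i (j + 1) hij
      have h4 : 3.52 * r * Real.exp (-τ (j + 1)) ≤ 1 * Real.exp (-τ (j + 1)) :=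
        mul_le_mul_of_nonneg_right (by norm_num at hr' ⊢; linarith) hp.le
      have h5 := Real.exp_pos (-τ i)
      linarith
  have hcoords : ∀ j, HasCoords Γ (3 * r) x₀ (v j) (u' j) (s' j) := fun j => by
    rw [hv]
    exact hasCoords_point Γ (by linarith [hu₃ j]) (by linarith [hs₁ j])
  have hsec : ∀ j, v j ∈ poincareSection Γ (3 * r) x₀ := fun j => ⟨_, _, hcoords j⟩
  have h02 : flow Γ (τ' 1) (v 0) = v 2 := hflow' 1
  have h10 : flow Γ (τ' 2) (v 1) = v 0 := hflow' 2
  have h21 : flow Γ (τ' 0) (v 2) = v 1 := hflow' 0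
  have hvC : ∀ j, v j ∈ orbit Γ (v 0) := by
    intro j
    fin_cases j
    · exact mem_orbit_self Γ _
    · exact ⟨τ' 1 + τ' 0, (flow_flow Γ _ _ _).symm.trans (by rw [h02, h21]; rfl)⟩
    · exact ⟨τ' 1, h02⟩
  have hne : ∀ σ₀ : ℝ, 4 * (3 * r) < σ₀ →
      (∀ γ ∈ Γ, γ ≠ 1 → ∀ g : G, σ₀ ≤ distG g (γ * g)) → ∀ j i, v j ≠ x i := by
    intro σ₀ hσ hdisp j i
    rw [hv, hx']
    refine point_ne_point Γ (A := 2 * r) (B := 3 * r) (C := r) (hsep j i) hdisp (hs₁ j) ?_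
      (hsr i).le ((separation_bound hr0 hr).trans hσ)
    linarith [abs_sub (u i) (u' j), hur i, hu₃ j]
  have hle : ∀ j, Real.exp (-τ j) ≤ Real.exp (-τ 0) + Real.exp (-τ 1) + Real.exp (-τ 2) := by
    have h0 := hE 0
    have h1 := hE 1
    have h2 := hE 2
    intro j
    fin_cases j <;> simp only [Fin.zero_eta, Fin.mk_one, Fin.reduceFinMk] <;> linarith
  have hr3 : 0 < r ^ 3 := by positivity
  have hr4 : 0 < r ^ 4 := by positivity
  refine ⟨orbit Γ (v 0), τ' 0 + τ' 1 + τ' 2, ⟨hC, ⟨?_, v 0, ?_, rfl⟩, 3, by norm_num, finRotate 3,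
    x, v, τ, τ', hxC, hvC, hτ, hτ'pos, ?_, ?_, ?_, ?_, ?_⟩, ?_, ⟨x₀, v, hvC, Or.inl hsec⟩,
    v, u', s', τ', hvC, hτ'pos, h02, h10, h21, rfl, hcoords, ?_, ?_, ?_, hdist, hsep, ?_⟩
  · linarith [hτ'pos 0, hτ'pos 1, hτ'pos 2]
  · rw [show τ' 0 + τ' 1 + τ' 2 = τ' 1 + τ' 0 + τ' 2 by ring, ← flow_flow, ← flow_flow, h02, h21,
      h10]
  · rw [hT, Fin.sum_univ_three]
  · rw [Fin.sum_univ_three]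
  · intro j
    rw [finRotate_apply]
    exact hflow j
  · intro j
    simp only [finRotate_apply]
    fin_cases j
    exacts [h02, h10, h21]
  · intro j
    rw [finRotate_apply]
    exact Or.inl fun t ht => (hdist j t ht).trans (by linarith)
  · have h := action_estimate hr hE (fun j => (hur j).le) (fun j => (hsr j).le) hl hl1 hu₁ hu₂
    have h1 : (τ' 0 + τ' 1 + τ' 2 - T) / 2 =
        Real.log (l 0) + Real.log (l 1) + Real.log (l 2) := by
      rw [hτ', hτ', hτ', hT]
      ring
    rw [h1]
    refine h.trans_lt ?_
    have e : ∀ j, 0 < r ^ 2 * Real.exp (-τ j) := fun j => by positivity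
    have e0 := e 0
    have e1 := e 1
    have e2 := e 2
    rw [mul_pow, mul_pow]
    linarith
  · intro j
    refine (hu₁ j).trans_lt ?_
    have h1 := mul_le_mul_of_nonneg_left (hle (j + 1)) hr0.le
    have h2 : 0 < r * (Real.exp (-τ 0) + Real.exp (-τ 1) + Real.exp (-τ 2)) := by positivity
    rw [mul_pow]
    norm_num
    linarith
  · intro j
    refine (hs₂ j).trans_lt ?_
    have h1 := mul_le_mul_of_nonneg_left (hle (j - 1)) hr0.le
    have h2 : 0 < r * (Real.exp (-τ 0) + Real.exp (-τ 1) + Real.exp (-τ 2)) := by positivity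
    rw [mul_pow]
    norm_num
    linarith
  · intro j
    rw [hτ', add_sub_cancel_left, abs_mul, abs_two, mul_pow]
    have h1 := hlog j
    have h2 : 0 < r ^ 2 := by positivity
    linarith
  · intro σ₀ hσ hdisp
    have hvx := hne σ₀ hσ hdisp
    -- If the new orbit were `D`, then `v 0` would be a section point of `D`, hence some `x i`. This
    -- serves both `C` and its time reversal.
    have key : ∀ D : Set (X Γ), D ∩ poincareSection Γ (3 * r) x₀ ⊆ Set.range x →
        orbit Γ (v 0) ≠ D := by
      rintro D hD rfl
      obtain ⟨i, hi⟩ := hD ⟨hvC 0, hsec 0⟩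
      exact hvx 0 i hi.symm
    exact ⟨hvx, key C, key _⟩
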